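/- Let $R=[r^1,\dots,r^k]\in\mathbb{Q}^{2\times k}$ have nonzero columns, let $f\in\mathbb{Q}^2\setminus\mathbb{Z}^2$, and put $$P(R,f)=\{(x,s)\in\mathbb{Z}^2\times\mathbb{R}^k_+ \mid x=f+Rs\},\qquad P(R,f)^0=\{(x,s)\in\mathbb{R}^2\times\mathbb{R}^k_+ \mid x=f+Rs\}.$$ For $n\ge 0$ let $$P(R,f)^{n+1}=\bigcap_{\pi\in\mathbb{Z}^2,\ \pi_0\in\mathbb{Z}}\operatorname{conv}\Big(\{(x,s)\in P(R,f)^n\mid \pi^Tx\le\pi_0\}\cup\{(x,s)\in P(R,f)^n\mid \pi^Tx\ge\pi_0+1\}\Big)$$ be the $(n+1)$-st split closure. The split rank of an inequality is the least $n$ for which it is valid for $P(R,f)^n$, and $+\infty$ if there is no such $n$. Let $\alpha\in\mathbb{R}^k_+$ be such that $\sum_{i=1}^k\alpha_is_i\ge 1$ is valid for $\operatorname{conv}(P(R,f))$. Its induced lattice-free set is $$L_\alpha=\operatorname{conv}\Big(\{f\}\cup\Big\{f+\frac{r^i}{\alpha_i}\;\Big|\;\alpha_i>0\Big\}\Big)+\operatorname{cone}\{r^i\mid\alpha_i=0\}.$$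 A quadrilateral of type $Q^2$ is a convex quadrilateral in $\mathbb{R}^2$ that has no integer point in its interior, has four non-integral vertices, and contains exactly one integer point in the relative interior of each of its four sides. **Proposition.** If $L_\alpha$ is a quadrilateral of type $Q^2$, then the split rank of $\sum_{i=1}^k\alpha_is_i\ge 1$ is finite. -/

import Mathlib

open scoped Pointwise

noncomputable section

/-- The integer lattice `ℤ²` inside the plane `ℝ²`. -/
def integerPoints : Set (Fin 2 → ℝ) :=
  {x | ∀ i, ∃ n : ℤ, x i = n}

/-- A set in the plane is lattice-free if its interior contains no integer point. -/
def LatticeFree (S : Set (Fin 2 → ℝ)) : Prop :=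
  Disjoint (interior S) integerPoints

/-- The rational vector `f`, as a point of `ℝ²`. -/
def realPoint (f : Fin 2 → ℚ) : Fin 2 → ℝ := fun i => (f i : ℝ)

/-- The `j`-th column `r^j` of the rational matrix `R`, as a vector of `ℝ²`. -/
def column {k : ℕ} (R : Matrix (Fin 2) (Fin k) ℚ) (j : Fin k) : Fin 2 → ℝ :=
  fun i => (R i j : ℝ)

/-- The linear relaxation `P(R,f)^0 = {(x,s) ∈ ℝ² × ℝ₊^k | x = f + R s}`. -/
def relaxation {k : ℕ} (R : Matrix (Fin 2) (Fin k) ℚ) (f : Fin 2 → ℚ) :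
    Set ((Fin 2 → ℝ) × (Fin k → ℝ)) :=
  {z | (∀ j, 0 ≤ z.2 j) ∧ z.1 = realPoint f + ∑ j, z.2 j • column R j}

/-- The mixed integer set `P(R,f) = {(x,s) ∈ ℤ² × ℝ₊^k | x = f + R s}`. -/
def mixedIntegerSet {k : ℕ} (R : Matrix (Fin 2) (Fin k) ℚ) (f : Fin 2 → ℚ) :
    Set ((Fin 2 → ℝ) × (Fin k → ℝ)) :=
  {z ∈ relaxation R f | z.1 ∈ integerPoints}

/-- The inequality `∑ α_j s_j ≥ γ` is valid for the set `K` of points `(x,s)`. -/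
def IsValidInequality {k : ℕ} (K : Set ((Fin 2 → ℝ) × (Fin k → ℝ)))
    (α : Fin k → ℝ) (γ : ℝ) : Prop :=
  ∀ z ∈ K, γ ≤ ∑ j, α j * z.2 j

/-- The convex hull `K_{π,π₀}` of the two parts of `K` that satisfy the split disjunction
`π·x ≤ π₀` or `π·x ≥ π₀ + 1`. -/
def splitHull {k : ℕ} (K : Set ((Fin 2 → ℝ) × (Fin k → ℝ))) (π : Fin 2 → ℤ) (π₀ : ℤ) :
    Set ((Fin 2 → ℝ) × (Fin k → ℝ)) :=
  convexHull ℝ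
    ({z ∈ K | ∑ i, (π i : ℝ) * z.1 i ≤ (π₀ : ℝ)} ∪
      {z ∈ K | (π₀ : ℝ) + 1 ≤ ∑ i, (π i : ℝ) * z.1 i})

/-- The split closure: the intersection of `K_{π,π₀}` over all split disjunctions. -/
def splitClosure {k : ℕ} (K : Set ((Fin 2 → ℝ) × (Fin k → ℝ))) :
    Set ((Fin 2 → ℝ) × (Fin k → ℝ)) :=
  ⋂ (π : Fin 2 → ℤ) (π₀ : ℤ), splitHull K π π₀

/-- The split rank of `∑ α_j s_j ≥ γ` with respect to `K`: the least `n` such that the inequality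
is valid for the `n`-th split closure of `K`, and `⊤` if there is no such `n`. -/
def splitRank {k : ℕ} (K : Set ((Fin 2 → ℝ) × (Fin k → ℝ))) (α : Fin k → ℝ) (γ : ℝ) : ℕ∞ :=
  sInf {m : ℕ∞ | ∃ n : ℕ, m = n ∧ IsValidInequality (splitClosure^[n] K) α γ}

/-- The induced lattice-free set
`L_α = conv ({f} ∪ {f + r^j / α_j | α_j > 0}) + cone {r^j | α_j = 0}`. -/
def inducedSet {k : ℕ} (R : Matrix (Fin 2) (Fin k) ℚ) (f : Fin 2 → ℚ) (α : Fin k → ℝ) :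
    Set (Fin 2 → ℝ) :=
  convexHull ℝ
      ({p | ∃ j, 0 < α j ∧ p = realPoint f + (1 / α j) • column R j} ∪ {realPoint f}) +
    {d | ∃ t : Fin k → ℝ, (∀ j, 0 ≤ t j) ∧ (∀ j, α j ≠ 0 → t j = 0) ∧
      d = ∑ j, t j • column R j}

/-- Twice the signed area of the triangle `a b c`; it is positive exactly when the path
`a, b, c` makes a strict left turn. -/
def leftTurn (a b c : Fin 2 → ℝ) : ℝ :=
  (b 0 - a 0) * (c 1 - a 1) - (b 1 - a 1) * (c 0 - a 0)

/-- `Q` is a lattice-free quadrilateral of type `Q²`. The vertices `v 0, v 1, v 2, v 3` are listed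
counterclockwise (four strict left turns), so the sides are the segments from `v i` to `v (i + 1)`,
with indices modulo `4`. No vertex is integral, and the relative interior of each side contains
exactly one integer point. -/
def IsType2Quadrilateral (Q : Set (Fin 2 → ℝ)) : Prop :=
  LatticeFree Q ∧
  ∃ v : Fin 4 → Fin 2 → ℝ,
    Q = convexHull ℝ (Set.range v) ∧
    (∀ i, 0 < leftTurn (v i) (v (i + 1)) (v (i + 2))) ∧
    (∀ i, v i ∉ integerPoints) ∧
    (∀ i, ∃! y, y ∈ integerPoints ∧ y ∈ openSegment ℝ (v i) (v (i + 1)))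

end

/-!
`L_α` is the projection to the plane of the part of `P(R, f)^0` on which `H = ∑ α_j s_j` is at most
`1`. Let `y₀, y₁, y₂, y₃` be the integer points on its four sides. Three consecutive ones span an
empty lattice triangle, so they are the vertices of a parallelogram of area `1`, and its side forms
`Λ_i`, which have integer coefficients and satisfy `Λ_i + Λ_{i+2} = 1`, yield split disjunctions.
The side of `L_α` through a vertex of the parallelogram gives the corner inequality
`1 ≤ H + p_i Λ_i + q_i Λ_{i+1}` there, where `p_i, q_i > 0`.

If in every corner either coefficient can be lowered to a common `m` at the expense of the other,
the splits on the `Λ_i` combine the four corners, first into `1 ≤ H + m Λ_i` and then into `1 ≤ H`.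
From `1 - ε ≤ H` one obtains such corners by averaging, with `1 - (1 - m / N) ε` in place of `1`,
where `N` bounds all `p_i` and `q_i`; so finitely many closures make the deficit `ε` arbitrarily
small, but not yet zero. Once it is small enough, a split nearly parallel to the corner lowers the
coefficient without any loss.
-/

open Filter Set

/-- The space `ℝ² × ℝᵏ` of the pairs `(x, s)`. -/
abbrev MixedSpace (k : ℕ) : Type := (Fin 2 → ℝ) × (Fin k → ℝ)

section SplitClosure

variable {k : ℕ} {K : Set (MixedSpace k)}

theorem splitClosure_subset (hK : Convex ℝ K) : splitClosure K ⊆ K :=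
  (iInter₂_subset 0 0).trans <|
    convexHull_min (union_subset (sep_subset _ _) (sep_subset _ _)) hK

theorem convex_splitClosure (K : Set (MixedSpace k)) : Convex ℝ (splitClosure K) :=
  convex_iInter₂ fun _ _ => convex_convexHull ℝ _

theorem convex_iterate_splitClosure (hK : Convex ℝ K) (n : ℕ) :
    Convex ℝ (splitClosure^[n] K) := by
  cases n with
  | zero => exact hK
  | succ n =>
    rw [Function.iterate_succ_apply']
    exact convex_splitClosure _

theorem antitone_iterate_splitClosure (hK : Convex ℝ K) :
    Antitone fun n => splitClosure^[n] K :=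
  antitone_nat_of_succ_le fun n => by
    rw [Function.iterate_succ_apply']
    exact splitClosure_subset (convex_iterate_splitClosure hK n)

/-- The filter generated by the iterated split closures of `K`. A property holds eventually along
it if it holds on some iterate, so that an inequality has finite split rank exactly when it holds
eventually. -/
def splitFilter (K : Set (MixedSpace k)) : Filter (MixedSpace k) :=
  ⨅ n, 𝓟 (splitClosure^[n] K)

theorem eventually_splitFilter (hK : Convex ℝ K) {p : MixedSpace k → Prop} :
    (∀ᶠ z in splitFilter K, p z) ↔ ∃ n, ∀ z ∈ splitClosure^[n] K, p z := by
  have hbasis := hasBasis_iInf_principal (antitone_iterate_splitClosure hK).directed_ge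
  exact hbasis.eventually_iff.trans <| by simp only [true_and]

theorem eventually_splitFilter_of_forall_mem {p : MixedSpace k → Prop} (h : ∀ z ∈ K, p z) :
    ∀ᶠ z in splitFilter K, p z :=
  (iInf_le (fun n => 𝓟 (splitClosure^[n] K)) 0) h

theorem splitRank_lt_top_of_eventually (hK : Convex ℝ K) {α : Fin k → ℝ} {γ : ℝ}
    (h : ∀ᶠ z in splitFilter K, γ ≤ ∑ j, α j * z.2 j) : splitRank K α γ < ⊤ := by
  obtain ⟨n, hn⟩ := (eventually_splitFilter hK).1 h
  have hle : splitRank K α γ ≤ n := sInf_le ⟨n, rfl, hn⟩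
  exact hle.trans_lt (ENat.natCast_lt_top n)

end SplitClosure

section SplitCuts

variable {k : ℕ}

/-- An affine function of `(x, s)` that depends on `x` only and has integer coefficients. Each such
`W` gives a split disjunction `W ≤ 0 ∨ 1 ≤ W`. -/
def IsIntegerForm (W : MixedSpace k →ᵃ[ℝ] ℝ) : Prop :=
  ∃ (π : Fin 2 → ℤ) (c : ℤ), ∀ z, W z = ∑ i, (π i : ℝ) * z.1 i + c

theorem IsIntegerForm.intCast_smul_add {X Y : MixedSpace k →ᵃ[ℝ] ℝ} (hX : IsIntegerForm X)
    (hY : IsIntegerForm Y) (P Q : ℤ) : IsIntegerForm ((P : ℝ) • X + (Q : ℝ) • Y) := by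
  obtain ⟨π, c, hπ⟩ := hX
  obtain ⟨ρ, d, hρ⟩ := hY
  refine ⟨P • π + Q • ρ, P * c + Q * d, fun z => ?_⟩
  simp only [AffineMap.coe_add, AffineMap.coe_smul, Pi.add_apply, Pi.smul_apply, smul_eq_mul, hπ,
    hρ, Fin.sum_univ_two]
  push_cast
  ring

variable {K : Set (MixedSpace k)} {H L W X Y : MixedSpace k →ᵃ[ℝ] ℝ} {c : ℝ}

theorem eventually_le_of_split (hK : Convex ℝ K) (hW : IsIntegerForm W)
    (h : ∀ᶠ z in splitFilter K, (W z ≤ 0 ∨ 1 ≤ W z) → c ≤ L z) :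
    ∀ᶠ z in splitFilter K, c ≤ L z := by
  obtain ⟨π, d, hπ⟩ := hW
  obtain ⟨n, hn⟩ := (eventually_splitFilter hK).1 h
  refine (eventually_splitFilter hK).2 ⟨n + 1, fun z hz => ?_⟩
  rw [Function.iterate_succ_apply'] at hz
  have hconvex : Convex ℝ (L ⁻¹' Ici c) := (convex_Ici c).affine_preimage L
  refine convexHull_min (union_subset ?_ ?_) hconvex (mem_iInter₂.1 hz π (-d))
  · rintro y ⟨hy, hle⟩
    exact hn y hy (.inl (by rw [hπ]; push_cast at hle; linarith))
  · rintro y ⟨hy, hle⟩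
    exact hn y hy (.inr (by rw [hπ]; push_cast at hle; linarith))

/-- The split `X ≤ 0 ∨ 1 ≤ X` tilts away the terms `τ X` and `σ (1 - X)`, each of which is
nonpositive on one side of the disjunction. -/
theorem eventually_le_of_facets (hK : Convex ℝ K) (hX : IsIntegerForm X) {τ σ : ℝ} (hτ : 0 ≤ τ)
    (hσ : 0 ≤ σ) (hzero : ∀ᶠ z in splitFilter K, c ≤ L z + τ * X z)
    (hone : ∀ᶠ z in splitFilter K, c ≤ L z + σ * (1 - X z)) :
    ∀ᶠ z in splitFilter K, c ≤ L z := by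
  refine eventually_le_of_split hK hX ?_
  filter_upwards [hzero, hone] with z hzero hone
  rintro (hle | hge) <;> nlinarith

/-- The split on `Λ (i + 3)` merges two adjacent corners into a side, and the split on `Λ 0` merges
two opposite sides. -/
theorem eventually_le_of_flat_corners (hK : Convex ℝ K) {Λ : Fin 4 → MixedSpace k →ᵃ[ℝ] ℝ}
    (hΛ : ∀ i, IsIntegerForm (Λ i)) (hopp : ∀ i z, Λ i z + Λ (i + 2) z = 1) {m : ℝ} (hm : 0 ≤ m)
    (hleft : ∀ i, ∃ τ, 0 ≤ τ ∧ ∀ᶠ z in splitFilter K, c ≤ H z + τ * Λ i z + m * Λ (i + 1) z)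
    (hright : ∀ i, ∃ σ, 0 ≤ σ ∧ ∀ᶠ z in splitFilter K, c ≤ H z + m * Λ i z + σ * Λ (i + 1) z) :
    ∀ᶠ z in splitFilter K, c ≤ H z := by
  have hside (i : Fin 4) : ∀ᶠ z in splitFilter K, c ≤ (H + m • Λ i) z := by
    obtain ⟨τ, hτ, hleft⟩ := hleft (i + 3)
    obtain ⟨σ, hσ, hright⟩ := hright i
    refine eventually_le_of_facets hK (hΛ (i + 3)) hτ hσ ?_ ?_
    · filter_upwards [hleft] with z hz
      simp only [add_assoc i, Fin.reduceAdd, add_zero] at hz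
      simp only [AffineMap.coe_add, AffineMap.coe_smul, Pi.add_apply, Pi.smul_apply, smul_eq_mul]
      linarith
    · filter_upwards [hright] with z hz
      have hsum := hopp (i + 1) z
      simp only [add_assoc i, Fin.reduceAdd] at hsum
      simp only [AffineMap.coe_add, AffineMap.coe_smul, Pi.add_apply, Pi.smul_apply, smul_eq_mul]
      rw [← hsum]
      linarith
  refine eventually_le_of_facets hK (hΛ 0) hm hm (by simpa using hside 0) ?_
  filter_upwards [hside 2] with z hz
  have hsum := hopp 0 z
  simp only [AffineMap.coe_add, AffineMap.coe_smul, Pi.add_apply, Pi.smul_apply, smul_eq_mul] at hz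
  rw [zero_add] at hsum
  rw [← hsum]
  linarith

end SplitCuts

theorem exists_pos_int_abs_mul_sub_mul_le {a b δ : ℝ} (hb : 0 < b) (hδ : 0 < δ) (hδa : δ < a) :
    ∃ P Q : ℤ, 0 < P ∧ 0 < Q ∧ |Q * a - P * b| ≤ δ := by
  obtain ⟨n, hn⟩ := exists_nat_ge (b / δ)
  obtain ⟨P, Q, hQ, -, happrox⟩ := Real.exists_int_int_abs_mul_sub_le (a / b) n.succ_pos
  have hle : |Q * a - P * b| ≤ δ := by
    have hfactor : Q * a - P * b = b * (Q * (a / b) - P) := by field_simp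
    rw [div_le_iff₀ hδ] at hn
    rw [le_div_iff₀ (by positivity)] at happrox
    push_cast at happrox
    rw [hfactor, abs_mul, abs_of_pos hb]
    nlinarith [abs_nonneg (Q * (a / b) - P)]
  have hP : 0 < P * b := by
    have hQone : (1 : ℝ) ≤ Q := by exact_mod_cast hQ
    nlinarith [(abs_le.1 hle).2]
  exact ⟨P, Q, by exact_mod_cast pos_of_mul_pos_left hP hb.le, hQ, hle⟩

theorem one_sub_le_tilt {m N s ε h t y : ℝ} (hm : 0 < m) (hms : m ≤ s) (hsN : s ≤ N) (hε : 0 ≤ ε)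
    (hh : 1 - ε ≤ h) (hcorner : 1 ≤ h + t + s * y) :
    1 - (1 - m / N) * ε ≤ h + m / s * t + m * y := by
  have hs : 0 < s := hm.trans_le hms
  have hratio : m / s ≤ 1 := (div_le_one hs).2 hms
  have hmN : m / N ≤ m / s := div_le_div_of_nonneg_left hm.le hs hsN
  calc 1 - (1 - m / N) * ε ≤ (1 - m / s) * (1 - ε) + m / s * 1 := by nlinarith
    _ ≤ (1 - m / s) * h + m / s * (h + t + s * y) := by gcongr
    _ = h + m / s * t + m * y := by field_simp; ring

theorem mul_abs_le_of_corners {m N h : ℝ} {l p q : Fin 4 → ℝ} (hm : 0 < m) (hh : 0 ≤ h)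
    (hp : ∀ i, m ≤ p i) (hq : ∀ i, m ≤ q i ∧ q i ≤ N) (hopp : ∀ i, l i + l (i + 2) = 1)
    (hcorner : ∀ i, 1 ≤ h + p i * l i + q i * l (i + 1)) (i : Fin 4) :
    m * |l i| ≤ h + (m + N) := by
  have hN : m ≤ N := (hq 0).1.trans (hq 0).2
  have hlower (i : Fin 4) : -(m * l i) ≤ h + N := by
    rcases le_total 0 (l i) with hnonneg | hnonpos
    · nlinarith
    rcases le_total (l (i + 1)) 1 with hle | hge
    · nlinarith [hcorner i, hp i, hq i, mul_nonneg (hm.le.trans (hq i).1) (sub_nonneg.2 hle)]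
    · have hneg : l (i + 3) ≤ 0 := by
        have hsum := hopp (i + 1)
        simp only [add_assoc i, Fin.reduceAdd] at hsum
        linarith
      have hcorner := hcorner (i + 3)
      simp only [add_assoc i, Fin.reduceAdd, add_zero] at hcorner
      nlinarith [hp (i + 3), (hq (i + 3)).1]
  rcases abs_cases (l i) with ⟨habs, -⟩ | ⟨habs, -⟩ <;> rw [habs]
  · nlinarith [hlower (i + 2), hopp i]
  · nlinarith [hlower i]

/-- The average of the lower bounds `1 - μ / (2 * Q)` and `κ * |x| - C` on `h`, with weights `1 - ν`
and `ν = δ / (Q * κ)`, absorbs the error term `d * x / Q`. -/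
theorem one_le_add_div_of_growth {κ C δ μ Q d h x w : ℝ} (hκ : 0 < κ) (hμ : 0 < μ) (hδ : 0 < δ)
    (hQ : 1 ≤ Q) (hδκ : δ ≤ κ) (hδC : 2 * δ * (1 + C) ≤ κ * μ) (hd : |d| ≤ δ)
    (hgrowth : κ * |x| ≤ h + C) (hdeficit : 1 - μ / (2 * Q) ≤ h) (hw : 1 ≤ w) :
    1 ≤ h + (μ * w + d * x) / Q := by
  have : 0 < Q := by linarith
  set ν := δ / (Q * κ) with hν
  have hν_pos : 0 < ν := by positivity
  have hν_one : ν ≤ 1 := by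
    rw [hν, div_le_one (by positivity)]
    nlinarith
  have herror : -(ν * (h + C)) ≤ d * x / Q := calc
    -(ν * (h + C)) ≤ -(ν * (κ * |x|)) := by gcongr
    _ = -(δ * |x|) / Q := by rw [hν]; field_simp
    _ ≤ d * x / Q := by
      gcongr
      refine (neg_le_neg ?_).trans (neg_abs_le (d * x))
      rw [abs_mul]
      gcongr
  have hhalf : μ / (2 * Q) + μ / (2 * Q) = μ / Q := by field_simp; ring
  have hgain : ν * (1 + C) ≤ μ / (2 * Q) := by
    rw [hν, div_mul_eq_mul_div, div_le_div_iff₀ (by positivity) (by positivity)]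
    nlinarith
  have hhalf_pos : 0 < μ / (2 * Q) := by positivity
  calc (1 : ℝ) ≤ (1 - ν) * (1 - μ / (2 * Q)) + μ / Q - ν * C := by nlinarith
    _ ≤ (1 - ν) * h + μ * w / Q - ν * C := by
      gcongr
      exact le_mul_of_one_le_right hμ.le hw
    _ ≤ h + (μ * w + d * x) / Q := by rw [add_div]; linarith

section Parallelogram

variable {k : ℕ} {K : Set (MixedSpace k)}

/-- By Dirichlet's theorem the corner is nearly parallel to an integer form `W = P X + Q Y`. Where
`W ≤ 0` the flattened inequality is weaker than the corner; where `1 ≤ W` it gains `μ / Q`, which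
outweighs both the error of the approximation and the deficit of `H`. -/
theorem exists_flat_corner (hK : Convex ℝ K) {H X Y : MixedSpace k →ᵃ[ℝ] ℝ}
    (hX : IsIntegerForm X) (hY : IsIntegerForm Y) {a b μ κ C : ℝ} (ha : 0 < a) (hμ : 0 < μ)
    (hμb : μ ≤ b) (hκ : 0 < κ) (hC : 0 ≤ C)
    (hcorner : ∀ᶠ z in splitFilter K, 1 ≤ H z + a * X z + b * Y z)
    (hgrowth : ∀ᶠ z in splitFilter K, κ * |X z| ≤ H z + C)
    (hdeficit : ∀ ε > 0, ∀ᶠ z in splitFilter K, 1 - ε ≤ H z) :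
    ∃ τ, 0 ≤ τ ∧ ∀ᶠ z in splitFilter K, 1 ≤ H z + τ * X z + μ * Y z := by
  obtain ⟨δ, hδ, hδlt⟩ :=
    exists_between (show 0 < min (min μ a) (min κ (κ * μ / (2 * (1 + C)))) by positivity)
  obtain ⟨⟨hδμ, hδa⟩, hδκ, hδC⟩ := by simpa only [lt_min_iff] using hδlt
  rw [lt_div_iff₀ (by positivity)] at hδC
  obtain ⟨P, Q, hP, hQ, happrox⟩ :=
    exists_pos_int_abs_mul_sub_mul_le (hμ.trans_le hμb) hδ hδa
  have hPone : (1 : ℝ) ≤ P := by exact_mod_cast hP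
  have hQone : (1 : ℝ) ≤ Q := by exact_mod_cast hQ
  set d := Q * a - P * b with hd
  refine ⟨(μ * P + d) / Q, div_nonneg (by nlinarith [(abs_le.1 happrox).1]) (by linarith), ?_⟩
  refine eventually_le_of_split (L := H + ((μ * P + d) / Q) • X + μ • Y) hK
    (hX.intCast_smul_add hY P Q) ?_
  filter_upwards [hcorner, hgrowth, hdeficit (μ / (2 * Q)) (by positivity)]
    with z hcorner hgrowth hdeficit
  simp only [AffineMap.coe_add, AffineMap.coe_smul, Pi.add_apply, Pi.smul_apply, smul_eq_mul]
  set W := P * X z + Q * Y z with hW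
  have hflat : H z + (μ * P + d) / Q * X z + μ * Y z = H z + (μ * W + d * X z) / Q := by
    rw [hW]
    field_simp
    ring
  rw [hflat]
  rintro (hle | hge)
  · calc (1 : ℝ) ≤ H z + a * X z + b * Y z := hcorner
      _ = H z + (b * W + d * X z) / Q := by rw [hW, hd]; field_simp; ring
      _ ≤ H z + (μ * W + d * X z) / Q := by gcongr H z + (?_ + _) / _; nlinarith
  · exact one_le_add_div_of_growth hκ hμ hδ hQone hδκ.le (by linarith) happrox hgrowth hdeficit hge

variable {H : MixedSpace k →ᵃ[ℝ] ℝ} {Λ : Fin 4 → MixedSpace k →ᵃ[ℝ] ℝ} {p q : Fin 4 → ℝ} {m N : ℝ}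

theorem eventually_one_sub_le (hK : Convex ℝ K) (hΛ : ∀ i, IsIntegerForm (Λ i))
    (hopp : ∀ i z, Λ i z + Λ (i + 2) z = 1) (hm : 0 < m) (hp : ∀ i, m ≤ p i ∧ p i ≤ N)
    (hq : ∀ i, m ≤ q i ∧ q i ≤ N) (hH : ∀ᶠ z in splitFilter K, 0 ≤ H z)
    (hcorner : ∀ i, ∀ᶠ z in splitFilter K, 1 ≤ H z + p i * Λ i z + q i * Λ (i + 1) z)
    {ε : ℝ} (hε : 0 < ε) : ∀ᶠ z in splitFilter K, 1 - ε ≤ H z := by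
  have hp_pos (i) : 0 < p i := hm.trans_le (hp i).1
  have hq_pos (i) : 0 < q i := hm.trans_le (hq i).1
  have hmN : m ≤ N := (hp 0).1.trans (hp 0).2
  have hcontract {ε : ℝ} (hε : 0 ≤ ε) (h : ∀ᶠ z in splitFilter K, 1 - ε ≤ H z) :
      ∀ᶠ z in splitFilter K, 1 - (1 - m / N) * ε ≤ H z := by
    refine eventually_le_of_flat_corners hK hΛ hopp hm.le (fun i => ?_) (fun i => ?_)
    · refine ⟨m / q i * p i, mul_nonneg (div_nonneg hm.le (hq_pos i).le) (hp_pos i).le, ?_⟩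
      filter_upwards [h, hcorner i] with z hz hcorner
      rw [mul_assoc]
      exact one_sub_le_tilt hm (hq i).1 (hq i).2 hε hz hcorner
    · refine ⟨m / p i * q i, mul_nonneg (div_nonneg hm.le (hp_pos i).le) (hq_pos i).le, ?_⟩
      filter_upwards [h, hcorner i] with z hz hcorner
      rw [mul_assoc, add_right_comm]
      exact one_sub_le_tilt hm (hp i).1 (hp i).2 hε hz (by rwa [add_right_comm])
  have hratio : 0 ≤ 1 - m / N := sub_nonneg.2 ((div_le_one (hm.trans_le hmN)).2 hmN)
  have hiterate (n : ℕ) : ∀ᶠ z in splitFilter K, 1 - (1 - m / N) ^ n ≤ H z := by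
    induction n with
    | zero => simpa only [pow_zero, sub_self] using hH
    | succ n ih => simpa only [pow_succ'] using hcontract (pow_nonneg hratio n) ih
  obtain ⟨n, hn⟩ := exists_pow_lt_of_lt_one hε (sub_lt_self 1 (div_pos hm (hm.trans_le hmN)))
  filter_upwards [hiterate n] with z hz
  linarith

theorem eventually_one_le_of_corners (hK : Convex ℝ K) (hΛ : ∀ i, IsIntegerForm (Λ i))
    (hopp : ∀ i z, Λ i z + Λ (i + 2) z = 1) (hp : ∀ i, 0 < p i) (hq : ∀ i, 0 < q i)
    (hH : ∀ᶠ z in splitFilter K, 0 ≤ H z)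
    (hcorner : ∀ i, ∀ᶠ z in splitFilter K, 1 ≤ H z + p i * Λ i z + q i * Λ (i + 1) z) :
    ∀ᶠ z in splitFilter K, 1 ≤ H z := by
  obtain ⟨i, hi⟩ := Finite.exists_min fun i => min (p i) (q i)
  obtain ⟨N, hN⟩ := Finite.exists_le fun i => max (p i) (q i)
  have hm : 0 < min (p i) (q i) := lt_min (hp i) (hq i)
  set m := min (p i) (q i)
  have hp (j) : m ≤ p j ∧ p j ≤ N :=
    ⟨(hi j).trans (min_le_left _ _), (le_max_left _ _).trans (hN j)⟩
  have hq (j) : m ≤ q j ∧ q j ≤ N :=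
    ⟨(hi j).trans (min_le_right _ _), (le_max_right _ _).trans (hN j)⟩
  have hC : 0 ≤ m + N := by linarith [hp 0]
  have hgrowth (j) : ∀ᶠ z in splitFilter K, m * |Λ j z| ≤ H z + (m + N) := by
    filter_upwards [hH, eventually_all.2 hcorner] with z hz hcorner
    exact mul_abs_le_of_corners hm hz (fun i => (hp i).1) hq (fun i => hopp i z) hcorner j
  have hdeficit (ε : ℝ) (hε : ε > 0) := eventually_one_sub_le hK hΛ hopp hm hp hq hH hcorner hε
  refine eventually_le_of_flat_corners hK hΛ hopp hm.le (fun j => ?_) (fun j => ?_)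
  · exact exists_flat_corner hK (hΛ j) (hΛ (j + 1)) (hm.trans_le (hp j).1) hm (hq j).1 hm hC
      (hcorner j) (hgrowth j) hdeficit
  · obtain ⟨τ, hτ, hflat⟩ := exists_flat_corner hK (hΛ (j + 1)) (hΛ j) (hm.trans_le (hq j).1) hm
      (hp j).1 hm hC ((hcorner j).mono fun z hz => by rwa [add_right_comm]) (hgrowth (j + 1))
      hdeficit
    exact ⟨τ, hτ, hflat.mono fun z hz => by rwa [add_right_comm]⟩

end Parallelogram

section Segment

variable {E : Type*} [AddCommGroup E] [Module ℝ E]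

theorem exists_lineMap_eq_of_mem_openSegment {a b x : E} (t : ℝ) (hx : x ∈ openSegment ℝ a b) :
    ∃ q ∈ ({a, b} : Set E), ∃ r ∈ Ico (0 : ℝ) 1,
      AffineMap.lineMap (AffineMap.lineMap a b t) q r = x := by
  rw [openSegment_eq_image_lineMap] at hx
  obtain ⟨u, ⟨hu₀, hu₁⟩, rfl⟩ := hx
  rcases le_or_gt t u with htu | hut
  · have ht : 0 < 1 - t := by linarith
    refine ⟨b, by simp, (u - t) / (1 - t),
      ⟨div_nonneg (by linarith) ht.le, (div_lt_one ht).2 (by linarith)⟩, ?_⟩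
    simp only [AffineMap.lineMap_apply_module]
    match_scalars <;> field_simp <;> ring
  · have ht : 0 < t := hu₀.trans hut
    refine ⟨a, by simp, (t - u) / t,
      ⟨div_nonneg (by linarith) ht.le, (div_lt_one ht).2 (by linarith)⟩, ?_⟩
    simp only [AffineMap.lineMap_apply_module]
    match_scalars <;> field_simp <;> ring

theorem affineMap_pos_of_mem_openSegment {g : E →ᵃ[ℝ] ℝ} {a b x : E}
    (hx : x ∈ openSegment ℝ a b) (ha : 0 ≤ g a) (hb : 0 ≤ g b) (hab : g a ≠ 0 ∨ g b ≠ 0) :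
    0 < g x := by
  obtain ⟨s, t, hs, ht, hst, rfl⟩ := hx
  rw [Convex.combo_affine_apply hst]
  simp only [smul_eq_mul]
  rcases hab with h | h
  · have := ha.lt_of_ne' h
    positivity
  · have := hb.lt_of_ne' h
    positivity

theorem add_sum_smul_mem_convexHull {ι : Type*} [Fintype ι] (f : E) (r : ι → E) {w : ι → ℝ}
    (hw : ∀ i, 0 ≤ w i) (hsum : ∑ i, w i ≤ 1) :
    f + ∑ i, w i • r i ∈ convexHull ℝ (insert f (range fun i => f + r i)) := by
  let w' : Option ι → ℝ := fun o => o.elim (1 - ∑ i, w i) w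
  let p : Option ι → E := fun o => o.elim f fun i => f + r i
  have hmem : ∑ o, w' o • p o ∈ convexHull ℝ (insert f (range fun i => f + r i)) := by
    refine (convex_convexHull ℝ _).sum_mem ?_ (by simp [w', Fintype.sum_option]) ?_
    · rintro (_ | i) -
      exacts [sub_nonneg.2 hsum, hw i]
    · rintro (_ | i) - <;> refine subset_convexHull ℝ _ ?_
      exacts [.inl rfl, .inr ⟨i, rfl⟩]
  convert hmem using 1
  simp only [w', p, Fintype.sum_option, Option.elim_none, Option.elim_some, smul_add,
    Finset.sum_add_distrib, ← Finset.sum_smul]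
  module

end Segment

section Plane

theorem leftTurn_self_left (a b : Fin 2 → ℝ) : leftTurn a b a = 0 := by
  unfold leftTurn
  ring

theorem leftTurn_self_right (a b : Fin 2 → ℝ) : leftTurn a b b = 0 := by
  unfold leftTurn
  ring

theorem leftTurn_rotate (a b c : Fin 2 → ℝ) : leftTurn b c a = leftTurn a b c := by
  unfold leftTurn
  ring

theorem leftTurn_swap (a b c : Fin 2 → ℝ) : leftTurn b a c = -leftTurn a b c := by
  unfold leftTurn
  ring

theorem leftTurn_add_leftTurn_add_leftTurn (a b c x : Fin 2 → ℝ) :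
    leftTurn b c x + leftTurn c a x + leftTurn a b x = leftTurn a b c := by
  unfold leftTurn
  ring

theorem leftTurn_smul_eq (a b c x : Fin 2 → ℝ) :
    leftTurn a b c • x = leftTurn b c x • a + leftTurn c a x • b + leftTurn a b x • c := by
  ext i
  fin_cases i <;>
    simp only [leftTurn, Fin.zero_eta, Fin.mk_one, Pi.smul_apply, smul_eq_mul, Pi.add_apply] <;>
    ring

theorem leftTurn_mul_leftTurn (a b c p q x : Fin 2 → ℝ) :
    leftTurn a b c * leftTurn p q x =
      leftTurn b c x * leftTurn p q a + leftTurn c a x * leftTurn p q b +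
        leftTurn a b x * leftTurn p q c := by
  unfold leftTurn
  ring

theorem leftTurn_add_leftTurn_of_add_eq_add {a b c d : Fin 2 → ℝ} (h : a + c = b + d)
    (x : Fin 2 → ℝ) : leftTurn a b x + leftTurn c d x = leftTurn a b c := by
  obtain rfl : c = b + d - a := eq_sub_of_add_eq' h
  simp only [leftTurn, Pi.add_apply, Pi.sub_apply]
  ring

theorem mem_of_leftTurn_nonneg {S : Set (Fin 2 → ℝ)} (hS : Convex ℝ S) {a b c x : Fin 2 → ℝ}
    (ha : a ∈ S) (hb : b ∈ S) (hc : c ∈ S) (habc : 0 < leftTurn a b c)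
    (hbc : 0 ≤ leftTurn b c x) (hca : 0 ≤ leftTurn c a x) (hab : 0 ≤ leftTurn a b x) :
    x ∈ S := by
  let w : Fin 3 → ℝ := ![leftTurn b c x, leftTurn c a x, leftTurn a b x]
  have hw : ∑ i, w i = leftTurn a b c := by
    simpa [w, Fin.sum_univ_three] using leftTurn_add_leftTurn_add_leftTurn a b c x
  have hx : x = Finset.univ.centerMass w ![a, b, c] := by
    rw [Finset.centerMass, hw, eq_inv_smul_iff₀ habc.ne', leftTurn_smul_eq]
    simp [w, Fin.sum_univ_three]
  rw [hx]
  refine hS.centerMass_mem ?_ (hw ▸ habc) ?_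
  · simpa [w, Fin.forall_fin_succ] using ⟨hbc, hca, hab⟩
  · simpa [Fin.forall_fin_succ] using ⟨ha, hb, hc⟩

/-- The function `leftTurn a b`, bundled as an affine map. -/
def leftTurnForm (a b : Fin 2 → ℝ) : (Fin 2 → ℝ) →ᵃ[ℝ] ℝ where
  toFun := leftTurn a b
  linear := (b 0 - a 0) • LinearMap.proj 1 - (b 1 - a 1) • LinearMap.proj 0
  map_vadd' x d := by
    simp only [leftTurn, Pi.vadd_apply', vadd_eq_add, LinearMap.sub_apply, LinearMap.smul_apply,
      LinearMap.coe_proj, Function.eval, smul_eq_mul]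
    ring

end Plane

section Lattice

/-- The integer points as an additive subgroup of the plane. -/
def integerLattice : AddSubgroup (Fin 2 → ℝ) where
  carrier := integerPoints
  zero_mem' i := ⟨0, by simp⟩
  add_mem' hx hy i := by
    obtain ⟨m, hm⟩ := hx i
    obtain ⟨n, hn⟩ := hy i
    exact ⟨m + n, by simp [hm, hn]⟩
  neg_mem' hx i := by
    obtain ⟨m, hm⟩ := hx i
    exact ⟨-m, by simp [hm]⟩

theorem mem_integerLattice {x : Fin 2 → ℝ} : x ∈ integerLattice ↔ x ∈ integerPoints := Iff.rfl

theorem exists_int_leftTurn_eq {a b c : Fin 2 → ℝ} (ha : a ∈ integerPoints)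
    (hb : b ∈ integerPoints) (hc : c ∈ integerPoints) : ∃ n : ℤ, leftTurn a b c = n := by
  choose a' ha' using ha
  choose b' hb' using hb
  choose c' hc' using hc
  exact ⟨(b' 0 - a' 0) * (c' 1 - a' 1) - (b' 1 - a' 1) * (c' 0 - a' 0), by
    simp [leftTurn, ha', hb', hc']⟩

variable {a b c : Fin 2 → ℝ}

theorem leftTurn_affine_coordinates (a b c : Fin 2 → ℝ) (s t : ℝ) :
    leftTurn c a (a + s • (b - a) + t • (c - a)) = s * leftTurn a b c ∧
      leftTurn a b (a + s • (b - a) + t • (c - a)) = t * leftTurn a b c := by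
  constructor <;> simp only [leftTurn, Pi.add_apply, Pi.smul_apply, Pi.sub_apply, smul_eq_mul] <;>
    ring

theorem exists_affine_coordinates (habc : leftTurn a b c ≠ 0) (x : Fin 2 → ℝ) :
    ∃ s t : ℝ, x = a + s • (b - a) + t • (c - a) := by
  refine ⟨leftTurn c a x / leftTurn a b c, leftTurn a b x / leftTurn a b c, ?_⟩
  have hsum := leftTurn_add_leftTurn_add_leftTurn a b c x
  have hx := leftTurn_smul_eq a b c x
  apply smul_right_injective _ habc
  simp only [smul_add, smul_smul, mul_div_cancel₀ _ habc]
  rw [hx, ← hsum]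
  module

theorem exists_lineMap_eq_of_leftTurn_eq_zero {a b c x : Fin 2 → ℝ} (habc : leftTurn a b c ≠ 0)
    (hx : leftTurn a b x = 0) : ∃ t : ℝ, AffineMap.lineMap a b t = x := by
  obtain ⟨s, t, rfl⟩ := exists_affine_coordinates habc x
  rw [(leftTurn_affine_coordinates a b c s t).2, mul_eq_zero_iff_right habc] at hx
  exact ⟨s, by rw [hx, AffineMap.lineMap_apply_module']; module⟩

theorem coordinates_of_empty_triangle (habc : 0 < leftTurn a b c)
    (hempty : integerPoints ∩ convexHull ℝ {a, b, c} ⊆ {a, b, c}) {s t : ℝ} (hs : 0 ≤ s)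
    (ht : 0 ≤ t) (hst : s + t ≤ 1) (hz : a + s • (b - a) + t • (c - a) ∈ integerPoints) :
    (s = 0 ∧ t = 0) ∨ (s = 1 ∧ t = 0) ∨ (s = 0 ∧ t = 1) := by
  obtain ⟨hleft, hright⟩ := leftTurn_affine_coordinates a b c s t
  set z := a + s • (b - a) + t • (c - a)
  have hmem : z ∈ convexHull ℝ {a, b, c} := by
    refine mem_of_leftTurn_nonneg (convex_convexHull ℝ _) (a := a) (b := b) (c := c)
      (subset_convexHull ℝ _ (by simp)) (subset_convexHull ℝ _ (by simp))
      (subset_convexHull ℝ _ (by simp)) habc ?_ ?_ ?_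
    · nlinarith [leftTurn_add_leftTurn_add_leftTurn a b c z]
    · rw [hleft]; positivity
    · rw [hright]; positivity
  rcases hempty ⟨hz, hmem⟩ with h | h | h <;> rw [h] at hleft hright
  · rw [leftTurn_self_right, eq_comm, mul_eq_zero_iff_right habc.ne'] at hleft
    rw [leftTurn_self_left, eq_comm, mul_eq_zero_iff_right habc.ne'] at hright
    exact .inl ⟨hleft, hright⟩
  · rw [leftTurn_rotate, leftTurn_rotate, eq_comm, mul_eq_right₀ habc.ne'] at hleft
    rw [leftTurn_self_right, eq_comm, mul_eq_zero_iff_right habc.ne'] at hright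
    exact .inr (.inl ⟨hleft, hright⟩)
  · rw [leftTurn_self_left, eq_comm, mul_eq_zero_iff_right habc.ne'] at hleft
    rw [eq_comm, mul_eq_right₀ habc.ne'] at hright
    exact .inr (.inr ⟨hleft, hright⟩)

/-- Reducing the coordinates of `x` modulo `1` moves it into the parallelogram spanned at `a`; the
half opposite to `a` is the reflection of the triangle. -/
theorem exists_int_leftTurn_eq_mul_of_empty_triangle (ha : a ∈ integerPoints)
    (hb : b ∈ integerPoints) (hc : c ∈ integerPoints) (habc : 0 < leftTurn a b c)
    (hempty : integerPoints ∩ convexHull ℝ {a, b, c} ⊆ {a, b, c}) {x : Fin 2 → ℝ}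
    (hx : x ∈ integerPoints) :
    ∃ m n : ℤ, leftTurn c a x = m * leftTurn a b c ∧ leftTurn a b x = n * leftTurn a b c := by
  obtain ⟨s, t, rfl⟩ : ∃ s t : ℝ, x = a + s • (b - a) + t • (c - a) :=
    exists_affine_coordinates habc.ne' x
  simp only [← mem_integerLattice] at ha hb hc hx
  have hfract : a + Int.fract s • (b - a) + Int.fract t • (c - a) ∈ integerLattice := by
    convert sub_mem (sub_mem hx (zsmul_mem (sub_mem hb ha) ⌊s⌋))
      (zsmul_mem (sub_mem hc ha) ⌊t⌋) using 1
    simp only [Int.fract, ← Int.cast_smul_eq_zsmul ℝ]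
    module
  have hs := Int.fract_nonneg s
  have ht := Int.fract_nonneg t
  have hs_lt := Int.fract_lt_one s
  have ht_lt := Int.fract_lt_one t
  have hzero : Int.fract s = 0 ∧ Int.fract t = 0 := by
    rcases le_or_gt (Int.fract s + Int.fract t) 1 with hle | hgt
    · have := coordinates_of_empty_triangle habc hempty hs ht hle hfract
      grind
    · have hreflect : a + (1 - Int.fract s) • (b - a) + (1 - Int.fract t) • (c - a) ∈
          integerLattice := by
        convert sub_mem (add_mem hb hc) hfract using 1
        module
      have := coordinates_of_empty_triangle habc hempty (sub_nonneg.2 hs_lt.le)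
        (sub_nonneg.2 ht_lt.le) (by linarith) hreflect
      grind
  obtain ⟨hleft, hright⟩ := leftTurn_affine_coordinates a b c s t
  refine ⟨⌊s⌋, ⌊t⌋, ?_, ?_⟩
  · rw [hleft, ← Int.floor_add_fract s, hzero.1, add_zero, Int.floor_intCast]
  · rw [hright, ← Int.floor_add_fract t, hzero.2, add_zero, Int.floor_intCast]

theorem leftTurn_eq_one_of_empty_triangle (ha : a ∈ integerPoints) (hb : b ∈ integerPoints)
    (hc : c ∈ integerPoints) (habc : 0 < leftTurn a b c)
    (hempty : integerPoints ∩ convexHull ℝ {a, b, c} ⊆ {a, b, c}) : leftTurn a b c = 1 := by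
  have hunit (i : Fin 2) : a + Pi.single i 1 ∈ integerPoints :=
    integerLattice.add_mem ha fun j => ⟨(Pi.single i 1 : Fin 2 → ℤ) j, by
      rcases eq_or_ne j i with rfl | hji <;> simp [*]⟩
  obtain ⟨m₀, n₀, hm₀, hn₀⟩ :=
    exists_int_leftTurn_eq_mul_of_empty_triangle ha hb hc habc hempty (hunit 0)
  obtain ⟨m₁, n₁, hm₁, hn₁⟩ :=
    exists_int_leftTurn_eq_mul_of_empty_triangle ha hb hc habc hempty (hunit 1)
  obtain ⟨d, hd⟩ := exists_int_leftTurn_eq ha hb hc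
  have hdet : leftTurn a b c = leftTurn c a (a + Pi.single 0 1) * leftTurn a b (a + Pi.single 1 1) -
      leftTurn c a (a + Pi.single 1 1) * leftTurn a b (a + Pi.single 0 1) := by
    simp only [leftTurn, Pi.add_apply, ne_eq, one_ne_zero, not_false_eq_true,
      Pi.single_eq_of_ne, add_zero, Pi.single_eq_same, add_sub_cancel_left, mul_one, zero_ne_one,
      sub_self, mul_zero, sub_zero, zero_sub, neg_sub]
    ring
  rw [hm₀, hn₀, hm₁, hn₁, hd] at hdet
  rw [hd] at habc ⊢
  have hmul : d * (d * (m₀ * n₁ - m₁ * n₀)) = d * 1 := by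
    have hreal : d * (d * (m₀ * n₁ - m₁ * n₀)) = (d : ℝ) := by linear_combination -hdet
    rw [mul_one]
    exact_mod_cast hreal
  have hd_pos : 0 < d := by exact_mod_cast habc
  have hunit := Int.eq_one_or_neg_one_of_mul_eq_one (mul_left_cancel₀ hd_pos.ne' hmul)
  have hd_one : d = 1 := by lia
  rw [hd_one, Int.cast_one]

end Lattice

section Quadrilateral

variable {v y : Fin 4 → Fin 2 → ℝ}

/-- The affine function that vanishes on the line through the side `i` of the quadrilateral `v` and
is positive to its left, hence inside if `v` is listed counterclockwise. -/
def sideForm (v : Fin 4 → Fin 2 → ℝ) (i : Fin 4) : (Fin 2 → ℝ) →ᵃ[ℝ] ℝ :=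
  leftTurnForm (v i) (v (i + 1))

theorem sideForm_apply (v : Fin 4 → Fin 2 → ℝ) (i : Fin 4) (x : Fin 2 → ℝ) :
    sideForm v i x = leftTurn (v i) (v (i + 1)) x := rfl

theorem sideForm_self (v : Fin 4 → Fin 2 → ℝ) (i : Fin 4) : sideForm v i (v i) = 0 :=
  leftTurn_self_left _ _

theorem sideForm_add_one (v : Fin 4 → Fin 2 → ℝ) (i : Fin 4) : sideForm v i (v (i + 1)) = 0 :=
  leftTurn_self_right _ _

theorem sideForm_add_three_pos (hv : ∀ i, 0 < leftTurn (v i) (v (i + 1)) (v (i + 2)))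
    (i : Fin 4) : 0 < sideForm v i (v (i + 3)) := by
  have h := hv (i + 3)
  simp only [add_assoc, Fin.reduceAdd, add_zero] at h
  rwa [sideForm_apply, leftTurn_rotate]

theorem sideForm_vertex_pos (hv : ∀ i, 0 < leftTurn (v i) (v (i + 1)) (v (i + 2))) {i j : Fin 4}
    (hji : j ≠ i) (hji' : j ≠ i + 1) : 0 < sideForm v i (v j) := by
  obtain rfl | rfl : j = i + 2 ∨ j = i + 3 := by grind
  · exact hv i
  · exact sideForm_add_three_pos hv i

theorem sideForm_vertex_nonneg (hv : ∀ i, 0 < leftTurn (v i) (v (i + 1)) (v (i + 2)))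
    (i j : Fin 4) : 0 ≤ sideForm v i (v j) := by
  rcases eq_or_ne j i with rfl | hji
  · exact (sideForm_self v j).ge
  rcases eq_or_ne j (i + 1) with rfl | hji'
  · exact (sideForm_add_one v i).ge
  · exact (sideForm_vertex_pos hv hji hji').le

theorem sideForm_nonneg (hv : ∀ i, 0 < leftTurn (v i) (v (i + 1)) (v (i + 2))) (i : Fin 4)
    {x : Fin 2 → ℝ} (hx : x ∈ convexHull ℝ (range v)) : 0 ≤ sideForm v i x :=
  convexHull_min (t := sideForm v i ⁻¹' Ici 0) (range_subset_iff.2 (sideForm_vertex_nonneg hv i))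
    ((convex_Ici 0).affine_preimage _) hx

theorem mem_interior_of_sideForm_pos (hv : ∀ i, 0 < leftTurn (v i) (v (i + 1)) (v (i + 2)))
    {x : Fin 2 → ℝ} (hx : ∀ i, 0 < sideForm v i x) : x ∈ interior (convexHull ℝ (range v)) := by
  have hopen : IsOpen (⋂ i, sideForm v i ⁻¹' Ioi 0) := isOpen_iInter_of_finite fun i =>
    isOpen_Ioi.preimage (sideForm v i).continuous_of_finiteDimensional
  refine interior_maximal (fun x hx => ?_) hopen (mem_iInter.2 hx)
  have hside (i) : 0 < leftTurn (v i) (v (i + 1)) x := mem_iInter.1 hx i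
  have hvertex (i) : v i ∈ convexHull ℝ (range v) := subset_convexHull ℝ _ (mem_range_self i)
  rcases le_total 0 (leftTurn (v 2) (v 0) x) with hdiagonal | hdiagonal
  · exact mem_of_leftTurn_nonneg (convex_convexHull ℝ _) (hvertex 0) (hvertex 1) (hvertex 2) (hv 0)
      (hside 1).le hdiagonal (hside 0).le
  · rw [leftTurn_swap, neg_nonpos] at hdiagonal
    exact mem_of_leftTurn_nonneg (convex_convexHull ℝ _) (hvertex 2) (hvertex 3) (hvertex 0) (hv 2)
      (hside 3).le hdiagonal (hside 2).le

theorem sideForm_sidePoint_eq_zero (hy : ∀ i, y i ∈ openSegment ℝ (v i) (v (i + 1))) (i : Fin 4) :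
    sideForm v i (y i) = 0 := by
  obtain ⟨s, t, -, -, hst, hyi⟩ := hy i
  rw [← hyi, Convex.combo_affine_apply hst, sideForm_self, sideForm_add_one, smul_zero, smul_zero,
    add_zero]

theorem sideForm_sidePoint_pos (hv : ∀ i, 0 < leftTurn (v i) (v (i + 1)) (v (i + 2)))
    (hy : ∀ i, y i ∈ openSegment ℝ (v i) (v (i + 1))) {i j : Fin 4} (hji : j ≠ i) :
    0 < sideForm v i (y j) := by
  refine affineMap_pos_of_mem_openSegment (hy j) (sideForm_vertex_nonneg hv i _)
    (sideForm_vertex_nonneg hv i _) ?_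
  rcases eq_or_ne j (i + 1) with rfl | hji'
  · exact .inr (sideForm_vertex_pos hv (by grind) (by grind)).ne'
  · exact .inl (sideForm_vertex_pos hv hji hji').ne'

theorem leftTurn_sidePoint_pos (hv : ∀ i, 0 < leftTurn (v i) (v (i + 1)) (v (i + 2)))
    (hy : ∀ i, y i ∈ openSegment ℝ (v i) (v (i + 1))) (i : Fin 4) :
    0 < leftTurn (y i) (y (i + 1)) (y (i + 2)) := by
  have hy₁ := hy (i + 1)
  have hy₂ := hy (i + 2)
  have h₁ := hv (i + 1)
  have h₂ := sideForm_add_three_pos hv i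
  have h₃ := hv (i + 2)
  simp only [add_assoc, Fin.reduceAdd, add_zero] at hy₁ hy₂ h₁ h₃
  rw [leftTurn_rotate] at h₃
  obtain ⟨s₀, t₀, hs₀, ht₀, hst₀, hy₀⟩ := hy i
  obtain ⟨s₁, t₁, hs₁, ht₁, hst₁, hy₁⟩ := hy₁
  obtain ⟨s₂, t₂, hs₂, ht₂, hst₂, hy₂⟩ := hy₂
  have hmultilinear : leftTurn (y i) (y (i + 1)) (y (i + 2)) =
      s₀ * s₁ * s₂ * leftTurn (v i) (v (i + 1)) (v (i + 2)) +
      s₀ * s₁ * t₂ * sideForm v i (v (i + 3)) +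
      s₀ * t₁ * t₂ * leftTurn (v i) (v (i + 2)) (v (i + 3)) +
      t₀ * t₁ * t₂ * leftTurn (v (i + 1)) (v (i + 2)) (v (i + 3)) := by
    obtain rfl : s₀ = 1 - t₀ := by linarith
    obtain rfl : s₁ = 1 - t₁ := by linarith
    obtain rfl : s₂ = 1 - t₂ := by linarith
    rw [← hy₀, ← hy₁, ← hy₂, sideForm_apply]
    simp only [leftTurn, Pi.add_apply, Pi.smul_apply, smul_eq_mul]
    ring
  have h₀ := hv i
  rw [hmultilinear]
  positivity

theorem convex_sideForm_pos_or_mem (hv : ∀ i, 0 < leftTurn (v i) (v (i + 1)) (v (i + 2)))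
    (hy : ∀ i, y i ∈ openSegment ℝ (v i) (v (i + 1))) {S : Set (Fin 2 → ℝ)} (hS : S ⊆ range y) :
    Convex ℝ {x | (∀ i, 0 < sideForm v i x) ∨ x ∈ S} := by
  have hzero {x : Fin 2 → ℝ} (hx : (∀ i, 0 < sideForm v i x) ∨ x ∈ S) (i : Fin 4) :
      0 ≤ sideForm v i x ∧ (sideForm v i x = 0 → x = y i) := by
    rcases hx with hpos | hmem
    · exact ⟨(hpos i).le, fun h => absurd h (hpos i).ne'⟩
    · obtain ⟨j, rfl⟩ := hS hmem
      rcases eq_or_ne j i with rfl | hji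
      · exact ⟨(sideForm_sidePoint_eq_zero hy j).ge, fun _ => rfl⟩
      · have hpos := sideForm_sidePoint_pos hv hy hji
        exact ⟨hpos.le, fun h => absurd h hpos.ne'⟩
  refine convex_iff_pairwise_pos.2 fun x hx x' hx' hne s t hs ht hst => .inl fun i => ?_
  refine affineMap_pos_of_mem_openSegment ⟨s, t, hs, ht, hst, rfl⟩ (hzero hx i).1 (hzero hx' i).1 ?_
  by_contra! h
  exact hne (((hzero hx i).2 h.1).trans ((hzero hx' i).2 h.2).symm)

theorem leftTurn_sidePoint_eq_one (hv : ∀ i, 0 < leftTurn (v i) (v (i + 1)) (v (i + 2)))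
    (hy : ∀ i, y i ∈ openSegment ℝ (v i) (v (i + 1))) (hint : ∀ i, y i ∈ integerPoints)
    (hfree : ∀ x ∈ integerPoints, ¬ ∀ i, 0 < sideForm v i x) (i : Fin 4) :
    leftTurn (y i) (y (i + 1)) (y (i + 2)) = 1 := by
  refine leftTurn_eq_one_of_empty_triangle (hint _) (hint _) (hint _)
    (leftTurn_sidePoint_pos hv hy i) fun x hx => ?_
  have hS : {y i, y (i + 1), y (i + 2)} ⊆ range y := by
    simp [insert_subset_iff]
  exact (convexHull_min (fun _ h => .inr h) (convex_sideForm_pos_or_mem hv hy hS) hx.2).resolve_left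
    (hfree x hx.1)

variable (hy : ∀ i, leftTurn (y i) (y (i + 1)) (y (i + 2)) = 1)
include hy

theorem leftTurn_add_three_eq_one (i : Fin 4) : leftTurn (y (i + 3)) (y i) (y (i + 1)) = 1 := by
  simpa only [add_assoc, Fin.reduceAdd, add_zero] using hy (i + 3)

theorem sidePoint_add_sidePoint (i : Fin 4) : y i + y (i + 2) = y (i + 1) + y (i + 3) := by
  have h₀ : leftTurn (y i) (y (i + 1)) (y (i + 3)) = 1 := by
    rw [leftTurn_rotate, leftTurn_add_three_eq_one hy]
  have h₁ : leftTurn (y (i + 1)) (y (i + 3)) (y (i + 2)) = -1 := by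
    rw [leftTurn_rotate, leftTurn_swap, ← hy (i + 1)]
    simp only [add_assoc, Fin.reduceAdd]
  have h₂ : leftTurn (y (i + 3)) (y i) (y (i + 2)) = 1 := by
    rw [leftTurn_rotate, ← hy (i + 2)]
    simp only [add_assoc, Fin.reduceAdd, add_zero]
  have hbarycentric := leftTurn_smul_eq (y i) (y (i + 1)) (y (i + 3)) (y (i + 2))
  rw [h₀, h₁, h₂, hy i] at hbarycentric
  rw [← one_smul ℝ (y (i + 2)), hbarycentric]
  module

theorem sideForm_add_sideForm_opposite (i : Fin 4) (x : Fin 2 → ℝ) :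
    sideForm y i x + sideForm y (i + 2) x = 1 := by
  have h := leftTurn_add_leftTurn_of_add_eq_add (sidePoint_add_sidePoint hy i) x
  rw [hy] at h
  simpa only [sideForm_apply, add_assoc, Fin.reduceAdd] using h

theorem sideForm_eq_of_sidePoint {i : Fin 4} (hi : sideForm v i (y i) = 0) (x : Fin 2 → ℝ) :
    sideForm v i x =
      sideForm v i (y (i + 3)) * sideForm y i x +
        sideForm v i (y (i + 1)) * sideForm y (i + 3) x := by
  have h := leftTurn_mul_leftTurn (y (i + 3)) (y i) (y (i + 1)) (v i) (v (i + 1)) x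
  rw [leftTurn_add_three_eq_one hy, one_mul, ← sideForm_apply v i (y i), hi, mul_zero, add_zero]
    at h
  simp only [sideForm_apply, add_assoc, Fin.reduceAdd, add_zero]
  linarith

end Quadrilateral

section ConvexCone

variable {k : ℕ} {K : Set (MixedSpace k)} {f : Fin 2 → ℝ} {α : Fin k → ℝ}

/-- The left-hand side `∑ α_j s_j` of the inequality, as a linear function of `(x, s)`. -/
def height (α : Fin k → ℝ) : MixedSpace k →ₗ[ℝ] ℝ :=
  ∑ j, α j • (LinearMap.proj j ∘ₗ LinearMap.snd ℝ _ _)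

theorem height_apply (α : Fin k → ℝ) (z : MixedSpace k) : height α z = ∑ j, α j * z.2 j := by
  simp [height]

/-- The projection to the `x`-plane of the part of `K` on which `∑ α_j s_j ≤ 1`. For
`K = P(R, f)^0` this is the lattice-free set `L_α`. -/
def projectedSublevel (K : Set (MixedSpace k)) (α : Fin k → ℝ) : Set (Fin 2 → ℝ) :=
  Prod.fst '' {z ∈ K | height α z ≤ 1}

theorem height_lineMap (α : Fin k → ℝ) (f : Fin 2 → ℝ) (z : MixedSpace k) (t : ℝ) :
    height α (AffineMap.lineMap (f, 0) z t) = t * height α z := by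
  have hapex : height α (f, 0) = 0 := by simp [height_apply]
  simp only [AffineMap.lineMap_apply_module, map_add, map_smul, hapex, smul_eq_mul, mul_zero,
    zero_add]

theorem isIntegerForm_sideForm {y : Fin 4 → Fin 2 → ℝ} (hint : ∀ i, y i ∈ integerPoints)
    (i : Fin 4) :
    IsIntegerForm ((sideForm y i).comp (LinearMap.fst ℝ _ (Fin k → ℝ)).toAffineMap) := by
  choose n hn using hint
  refine ⟨![n i 1 - n (i + 1) 1, n (i + 1) 0 - n i 0],
    n (i + 1) 1 * n i 0 - n (i + 1) 0 * n i 1, fun z => ?_⟩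
  simp only [AffineMap.coe_comp, LinearMap.coe_toAffineMap, LinearMap.coe_fst, Function.comp_apply,
    sideForm_apply, leftTurn, hn, Fin.sum_univ_two, Matrix.cons_val_zero, Int.cast_sub,
    Matrix.cons_val_one, Matrix.cons_val_fin_one, Int.cast_mul]
  ring

variable (hcone : ∀ z ∈ K, ∀ t : ℝ, 0 ≤ t → AffineMap.lineMap (f, 0) z t ∈ K)
include hcone

theorem lineMap_mem_projectedSublevel {z : MixedSpace k} (hz : z ∈ K) {t : ℝ} (ht : 0 ≤ t)
    (hle : t * height α z ≤ 1) : AffineMap.lineMap f z.1 t ∈ projectedSublevel K α :=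
  ⟨AffineMap.lineMap (f, 0) z t, ⟨hcone z hz t ht, by rwa [height_lineMap]⟩,
    AffineMap.fst_lineMap _ _ _⟩

theorem apex_mem_projectedSublevel (hK : K.Nonempty) : f ∈ projectedSublevel K α := by
  obtain ⟨z, hz⟩ := hK
  simpa using lineMap_mem_projectedSublevel hcone hz le_rfl (by simp)

theorem lineMap_notMem_integerPoints
    (hvalid : IsValidInequality {z ∈ K | z.1 ∈ integerPoints} α 1) {q : Fin 2 → ℝ}
    (hq : q ∈ projectedSublevel K α) {t : ℝ} (ht : t ∈ Ico 0 1) :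
    AffineMap.lineMap f q t ∉ integerPoints := by
  obtain ⟨z, ⟨hz, hle⟩, rfl⟩ := hq
  intro hint
  have hone := hvalid (AffineMap.lineMap (f, 0) z t)
    ⟨hcone z hz t ht.1, by rwa [AffineMap.fst_lineMap]⟩
  rw [← height_apply, height_lineMap] at hone
  nlinarith [ht.1, ht.2]

/-- Scaling `z` to height `1`, or along the whole ray if its height is `0`, keeps its projection in
the sublevel set, where `g` is nonnegative. -/
theorem apex_le_mul_height_add (hα : ∀ z ∈ K, 0 ≤ height α z) {g : (Fin 2 → ℝ) →ᵃ[ℝ] ℝ}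
    (hg : ∀ x ∈ projectedSublevel K α, 0 ≤ g x) {z : MixedSpace k} (hz : z ∈ K) :
    g f ≤ g f * height α z + g z.1 := by
  have hray {t : ℝ} (ht : 0 ≤ t) (hle : t * height α z ≤ 1) : 0 ≤ g f + t * (g z.1 - g f) := by
    have h := hg _ (lineMap_mem_projectedSublevel hcone hz ht hle)
    rwa [AffineMap.apply_lineMap, AffineMap.lineMap_apply_ring', add_comm] at h
  rcases (hα z hz).eq_or_lt with hzero | hpos
  · rw [← hzero, mul_zero, zero_add]
    by_contra! hlt
    have hapex : 0 ≤ g f := by simpa using hray le_rfl (by simp)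
    have hsub : 0 < g f - g z.1 := sub_pos.2 hlt
    have h := hray (t := (g f + 1) / (g f - g z.1)) (by positivity) (by simp [← hzero])
    rw [← neg_sub (g f), mul_neg, div_mul_cancel₀ _ hsub.ne'] at h
    linarith
  · have h := mul_nonneg hpos.le (hray (inv_nonneg.2 hpos.le) (inv_mul_cancel₀ hpos.ne').le)
    rw [mul_add, mul_inv_cancel_left₀ hpos.ne'] at h
    linarith

theorem one_le_height_add_div (hα : ∀ z ∈ K, 0 ≤ height α z) {g : (Fin 2 → ℝ) →ᵃ[ℝ] ℝ}
    (hg : ∀ x ∈ projectedSublevel K α, 0 ≤ g x) (hapex : 0 < g f) {z : MixedSpace k} (hz : z ∈ K) :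
    1 ≤ height α z + g z.1 / g f := by
  have h := (div_le_div_iff_of_pos_right hapex).2 (apex_le_mul_height_add hcone hα hg hz)
  rwa [add_div, mul_div_cancel_left₀ _ hapex.ne', div_self hapex.ne'] at h

theorem one_le_height_add_corner (hα : ∀ z ∈ K, 0 ≤ height α z) {v y : Fin 4 → Fin 2 → ℝ}
    (hv : ∀ i, 0 < leftTurn (v i) (v (i + 1)) (v (i + 2)))
    (hy : ∀ i, leftTurn (y i) (y (i + 1)) (y (i + 2)) = 1)
    (hL : projectedSublevel K α = convexHull ℝ (range v)) {i : Fin 4}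
    (hside : sideForm v (i + 1) (y (i + 1)) = 0) (hapex : 0 < sideForm v (i + 1) f)
    {z : MixedSpace k} (hz : z ∈ K) :
    1 ≤ height α z + sideForm v (i + 1) (y (i + 2)) / sideForm v (i + 1) f * sideForm y i z.1 +
      sideForm v (i + 1) (y i) / sideForm v (i + 1) f * sideForm y (i + 1) z.1 := by
  have hcorner := one_le_height_add_div hcone hα
    (fun x hx => sideForm_nonneg hv (i + 1) (hL ▸ hx)) hapex hz
  rw [sideForm_eq_of_sidePoint hy hside, add_div, mul_div_right_comm, mul_div_right_comm] at hcorner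
  simp only [add_assoc i, Fin.reduceAdd, add_zero] at hcorner ⊢
  linarith

/-- If `f` were on the side `i`, the integer point of that side would lie strictly between `f` and
another point of the side. -/
theorem sideForm_apex_pos (hvalid : IsValidInequality {z ∈ K | z.1 ∈ integerPoints} α 1)
    {v : Fin 4 → Fin 2 → ℝ} (hL : projectedSublevel K α = convexHull ℝ (range v))
    (hv : ∀ i, 0 < leftTurn (v i) (v (i + 1)) (v (i + 2))) {i : Fin 4} {x : Fin 2 → ℝ}
    (hint : x ∈ integerPoints) (hx : x ∈ openSegment ℝ (v i) (v (i + 1))) :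
    0 < sideForm v i f := by
  have hvertex (j) : v j ∈ projectedSublevel K α :=
    hL ▸ subset_convexHull ℝ _ (mem_range_self j)
  have hapex : f ∈ convexHull ℝ (range v) := by
    obtain ⟨z, hz, -⟩ := hvertex 0
    exact hL ▸ apex_mem_projectedSublevel hcone ⟨z, hz.1⟩
  refine (sideForm_nonneg hv i hapex).lt_of_ne' fun hzero => ?_
  obtain ⟨t, rfl⟩ := exists_lineMap_eq_of_leftTurn_eq_zero (hv i).ne' hzero
  obtain ⟨q, hq, r, hr, rfl⟩ := exists_lineMap_eq_of_mem_openSegment t hx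
  refine lineMap_notMem_integerPoints hcone hvalid ?_ hr hint
  rcases hq with rfl | rfl <;> exact hvertex _

end ConvexCone

section Relaxation

variable {k : ℕ} (R : Matrix (Fin 2) (Fin k) ℚ) (f : Fin 2 → ℚ)

/-- The affine map `s ↦ (f + R s, s)`, which parametrizes the linear relaxation by the nonnegative
orthant. -/
def relaxationMap : (Fin k → ℝ) →ᵃ[ℝ] MixedSpace k :=
  (AffineMap.const ℝ _ (realPoint f) +
    (Fintype.linearCombination ℝ (column R)).toAffineMap).prod (AffineMap.id ℝ _)

theorem relaxationMap_apply (s : Fin k → ℝ) :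
    relaxationMap R f s = (realPoint f + ∑ j, s j • column R j, s) := by
  simp [relaxationMap, Fintype.linearCombination_apply]

theorem relaxation_eq_image : relaxation R f = relaxationMap R f '' Ici 0 := by
  ext ⟨x, s⟩
  simp only [relaxation, mem_image, mem_Ici, relaxationMap_apply, Prod.mk.injEq, Set.mem_ofPred_eq,
    Pi.le_def, Pi.zero_apply]
  constructor
  · rintro ⟨hs, rfl⟩
    exact ⟨s, hs, rfl, rfl⟩
  · rintro ⟨s, hs, rfl, rfl⟩
    exact ⟨hs, rfl⟩

theorem convex_relaxation : Convex ℝ (relaxation R f) := by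
  rw [relaxation_eq_image]
  exact (convex_Ici 0).affine_image _

theorem lineMap_mem_relaxation {z : MixedSpace k} (hz : z ∈ relaxation R f) {t : ℝ} (ht : 0 ≤ t) :
    AffineMap.lineMap (realPoint f, 0) z t ∈ relaxation R f := by
  rw [relaxation_eq_image] at hz ⊢
  obtain ⟨s, hs, rfl⟩ := hz
  have hapex : relaxationMap R f 0 = (realPoint f, 0) := by simp [relaxationMap_apply]
  refine ⟨t • s, smul_nonneg ht (mem_Ici.1 hs), ?_⟩
  rw [← hapex, ← AffineMap.apply_lineMap, AffineMap.lineMap_apply_module, smul_zero, zero_add]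

variable {R f} {α : Fin k → ℝ}

theorem mem_projectedSublevel_relaxation {x : Fin 2 → ℝ} :
    x ∈ projectedSublevel (relaxation R f) α ↔
      ∃ s : Fin k → ℝ, 0 ≤ s ∧ ∑ j, α j * s j ≤ 1 ∧ realPoint f + ∑ j, s j • column R j = x := by
  rw [projectedSublevel, relaxation_eq_image]
  constructor
  · rintro ⟨_, ⟨⟨s, hs, rfl⟩, hle⟩, rfl⟩
    rw [relaxationMap_apply] at hle ⊢
    exact ⟨s, hs, by rwa [height_apply] at hle, rfl⟩
  · rintro ⟨s, hs, hle, rfl⟩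
    refine ⟨relaxationMap R f s, ⟨⟨s, hs, rfl⟩, ?_⟩, ?_⟩
    · rwa [height_apply, relaxationMap_apply]
    · rw [relaxationMap_apply]

theorem inducedSet_subset_projectedSublevel :
    inducedSet R f α ⊆ projectedSublevel (relaxation R f) α := by
  have hconvex : Convex ℝ (projectedSublevel (relaxation R f) α) :=
    ((convex_relaxation R f).inter
      ((convex_Iic 1).linear_preimage (height α))).linear_image (LinearMap.fst ℝ _ _)
  have hhull : convexHull ℝ
      ({p | ∃ j, 0 < α j ∧ p = realPoint f + (1 / α j) • column R j} ∪ {realPoint f}) ⊆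
      projectedSublevel (relaxation R f) α := by
    refine convexHull_min (union_subset ?_ ?_) hconvex
    · rintro _ ⟨j, hj, rfl⟩
      refine mem_projectedSublevel_relaxation.2 ⟨Pi.single j (1 / α j), ?_, ?_, ?_⟩
      · exact Pi.single_nonneg.2 (by positivity)
      · simp [Pi.single_apply, hj.ne']
      · simp [Pi.single_apply]
    · rintro _ rfl
      exact mem_projectedSublevel_relaxation.2 ⟨0, le_rfl, by simp, by simp⟩
  rintro _ ⟨p, hp, _, ⟨t, ht, htα, rfl⟩, rfl⟩
  obtain ⟨s, hs, hle, rfl⟩ := mem_projectedSublevel_relaxation.1 (hhull hp)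
  have hflat (j) : α j * t j = 0 := by
    by_cases hj : α j = 0
    · rw [hj, zero_mul]
    · rw [htα j hj, mul_zero]
  refine mem_projectedSublevel_relaxation.2 ⟨s + t, add_nonneg hs ht, ?_, ?_⟩
  · simpa only [Pi.add_apply, mul_add, hflat, add_zero] using hle
  · simp only [Pi.add_apply, add_smul, Finset.sum_add_distrib, add_assoc]

theorem inducedSet_eq_projectedSublevel (hα : ∀ j, 0 ≤ α j) :
    inducedSet R f α = projectedSublevel (relaxation R f) α := by
  refine inducedSet_subset_projectedSublevel.antisymm fun x hx => ?_
  obtain ⟨s, hs, hle, rfl⟩ := mem_projectedSublevel_relaxation.1 hx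
  have hsplit (j) : s j • column R j =
      (α j * s j) • (1 / α j) • column R j + (if α j = 0 then s j else 0) • column R j := by
    split_ifs with hj
    · simp [hj]
    · rw [zero_smul, add_zero, smul_smul]
      field_simp
  refine ⟨realPoint f + ∑ j, (α j * s j) • (1 / α j) • column R j,
    convexHull_mono (insert_subset (.inr rfl) (range_subset_iff.2 fun j => ?_))
      (add_sum_smul_mem_convexHull _ _ (fun j => mul_nonneg (hα j) (hs j)) hle),
    ∑ j, (if α j = 0 then s j else 0) • column R j,
    ⟨_, fun j => ?_, fun j hj => if_neg hj, rfl⟩, ?_⟩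
  · rcases (hα j).eq_or_lt with hj | hj
    · -- Here the point is `realPoint f`, since `1 / 0 = 0`.
      exact .inr (by simp [← hj])
    · exact .inl ⟨j, hj, rfl⟩
  · split_ifs
    exacts [hs j, le_rfl]
  · simp only [hsplit, Finset.sum_add_distrib, add_assoc]

end Relaxation

theorem mainTheorem6_general {k : ℕ} {K : Set (MixedSpace k)} {f : Fin 2 → ℝ} (hK : Convex ℝ K)
    (hcone : ∀ z ∈ K, ∀ t : ℝ, 0 ≤ t → AffineMap.lineMap (f, 0) z t ∈ K) {α : Fin k → ℝ}
    (hα : ∀ z ∈ K, 0 ≤ height α z)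
    (hvalid : IsValidInequality {z ∈ K | z.1 ∈ integerPoints} α 1)
    (hQ : IsType2Quadrilateral (projectedSublevel K α)) : splitRank K α 1 < ⊤ := by
  obtain ⟨hfree, v, hL, hv, -, hside⟩ := hQ
  choose y hy using fun i => (hside i).exists
  have hint (i) : y i ∈ integerPoints := (hy i).1
  have hsegment (i) : y i ∈ openSegment ℝ (v i) (v (i + 1)) := (hy i).2
  have hunimodular := leftTurn_sidePoint_eq_one hv hsegment hint fun x hx hpos =>
    disjoint_left.1 hfree (hL ▸ mem_interior_of_sideForm_pos hv hpos) hx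
  have hapex (i) := sideForm_apex_pos hcone hvalid hL hv (hint i) (hsegment i)
  have hsidePoint {i j : Fin 4} (hji : j ≠ i) : 0 < sideForm v i (y j) / sideForm v i f :=
    div_pos (sideForm_sidePoint_pos hv hsegment hji) (hapex i)
  refine splitRank_lt_top_of_eventually hK ?_
  simp only [← height_apply]
  refine eventually_one_le_of_corners (H := (height α).toAffineMap) hK
    (isIntegerForm_sideForm hint) (fun i z => sideForm_add_sideForm_opposite hunimodular i z.1)
    (p := fun i => sideForm v (i + 1) (y (i + 2)) / sideForm v (i + 1) f)
    (q := fun i => sideForm v (i + 1) (y i) / sideForm v (i + 1) f)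
    (fun i => hsidePoint (by grind)) (fun i => hsidePoint (by grind))
    (eventually_splitFilter_of_forall_mem hα) fun i => ?_
  exact eventually_splitFilter_of_forall_mem fun z hz => one_le_height_add_corner hcone hα hv
    hunimodular hL (sideForm_sidePoint_eq_zero hsegment (i + 1)) (hapex (i + 1)) hz

theorem mainTheorem6 {k : ℕ} (R : Matrix (Fin 2) (Fin k) ℚ) (f : Fin 2 → ℚ)
    (hf : realPoint f ∉ integerPoints)
    (hR : ∀ j, column R j ≠ 0)
    (α : Fin k → ℝ) (hα : ∀ j, 0 ≤ α j)
    (hvalid : IsValidInequality (convexHull ℝ (mixedIntegerSet R f)) α 1)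
    (hQ : IsType2Quadrilateral (inducedSet R f α)) :
    splitRank (relaxation R f) α 1 < ⊤ := by
  rw [inducedSet_eq_projectedSublevel hα] at hQ
  refine mainTheorem6_general (convex_relaxation R f) (fun _ hz _ => lineMap_mem_relaxation R f hz)
    (fun z hz => ?_) (fun z hz => hvalid z (subset_convexHull ℝ _ hz)) hQ
  rw [height_apply]
  exact Finset.sum_nonneg fun j _ => mul_nonneg (hα j) (hz.1 j)
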